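/- Let $k=\min(m,n)$ and let $M^\star\in\mathbb{R}^{m\times n}$ have singular value decomposition $M^\star=P\,\mathrm{diag}(\sigma_1,\dots,\sigma_k)\,Q^\top$, where $P=[p_1,\dots,p_k]\in\mathbb{R}^{m\times k}$ and $Q=[q_1,\dots,q_k]\in\mathbb{R}^{n\times k}$ have orthonormal columns and $\sigma_1>\sigma_2>\dots>\sigma_k>0$. For $r\le k$ put $A_r=\sum_{i=1}^r\sigma_i p_iq_i^\top$. For $S\subseteq[k]=\{1,\dots,k\}$ let $\Pi_S\in\mathbb{R}^{k\times k}$ be the diagonal matrix whose $i$-th diagonal entry is $1$ if $i\in S$ and $0$ otherwise. For $U\in\mathbb{R}^{m\times k}$ and $V\in\mathbb{R}^{n\times k}$ define the best submodel optimality gap $$\mathcal{E}(U,V,r)=\min_{S\subseteq[k],\ |S|=r}\ \|U\Pi_SV^\top-A_r\|_F^2 .$$ Let $(U,V)$ be any global minimizer over $\mathbb{R}^{m\times k}\times\mathbb{R}^{n\times k}$ of the all-subspaces learning (ASL) objective $$\frac{1}{2^k-1}\sum_{\emptyset\ne S\subseteq[k]}\|U\Pi_SV^\top-M^\star\|_F^2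 ,$$ and set $\lambda=\frac1k\|UV^\top\|_\star$, where $\|\cdot\|_\star$ is the nuclear norm (the sum of the singular values). Then for every $r\in\{1,\dots,k\}$, $$\mathcal{E}(U,V,r)\ \ge\ \frac1k\Bigl(r\lambda-\sum_{i=1}^r\sigma_i\Bigr)^2 .$$ Moreover, for all spectra $\sigma=(\sigma_1,\dots,\sigma_k)$ with $\sigma_1>\dots>\sigma_k>0$ outside a set of Lebesgue measure zero in $\mathbb{R}^k$ that depends only on $m,n$, the following holds for every $M^\star$ with these singular values and every ASL minimizer $(U,V)$: the right-hand side above is strictly positive for every $1\le r<k$, and, if $k\ge2$, the gap $\mathcal{E}(U,V,r)$ is strictly positive simultaneously for all $r\in\{1,\dots,k\}$. -/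

import Mathlib

open scoped Matrix

-- `‖A‖` for a matrix is the Frobenius norm `(∑ i, ∑ j, |A i j| ^ 2) ^ (1 / 2)`.
attribute [local instance] Matrix.frobeniusNormedAddCommGroup

namespace ElasticLinear

/-- The diagonal 0/1 projector `Π_S` onto the coordinates in `S ⊆ [k]`. -/
def mask {k : ℕ} (S : Finset (Fin k)) : Matrix (Fin k) (Fin k) ℝ :=
  Matrix.diagonal fun i => if i ∈ S then 1 else 0

/-- The nuclear norm: the sum of all singular values (those with index at least the rank of `W`
vanish, in particular all those with index `≥ min m n`). -/
noncomputable def nuclearNorm {m n : ℕ} (W : Matrix (Fin m) (Fin n) ℝ) : ℝ :=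
  ∑ i ∈ Finset.range n, (Matrix.toEuclideanLin W).singularValues i

/-- The all-subspaces learning objective: the average over the `2 ^ k - 1` nonempty masks `S` of
`‖U Π_S Vᵀ - M‖_F ^ 2`. -/
noncomputable def aslObjective {m n k : ℕ} (M : Matrix (Fin m) (Fin n) ℝ)
    (U : Matrix (Fin m) (Fin k) ℝ) (V : Matrix (Fin n) (Fin k) ℝ) : ℝ :=
  1 / ((2 : ℝ) ^ k - 1) *
    ∑ S : Finset (Fin k) with S.Nonempty, ‖U * mask S * Vᵀ - M‖ ^ 2

/-- `(U, V)` is a global minimizer of the all-subspaces learning objective. -/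
def IsASLMinimizer {m n k : ℕ} (M : Matrix (Fin m) (Fin n) ℝ)
    (U : Matrix (Fin m) (Fin k) ℝ) (V : Matrix (Fin n) (Fin k) ℝ) : Prop :=
  ∀ (U' : Matrix (Fin m) (Fin k) ℝ) (V' : Matrix (Fin n) (Fin k) ℝ),
    aslObjective M U V ≤ aslObjective M U' V'

/-- `M = P diag(σ) Qᵀ` is a (thin) singular value decomposition of `M` with pairwise distinct
positive singular values in decreasing order. -/
structure IsSimpleSVD {m n k : ℕ} (M : Matrix (Fin m) (Fin n) ℝ)
    (P : Matrix (Fin m) (Fin k) ℝ) (σ : Fin k → ℝ) (Q : Matrix (Fin n) (Fin k) ℝ) : Prop where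
  left_orthonormal : Pᵀ * P = 1
  right_orthonormal : Qᵀ * Q = 1
  eq_mul : M = P * Matrix.diagonal σ * Qᵀ
  strictAnti : StrictAnti σ
  pos : ∀ i, 0 < σ i

/-- The rank-`r` truncation `A_r = ∑_{i ≤ r} σ_i p_i q_iᵀ` (indices start at `0` here). -/
noncomputable def truncatedSVD {m n k : ℕ} (P : Matrix (Fin m) (Fin k) ℝ) (σ : Fin k → ℝ)
    (Q : Matrix (Fin n) (Fin k) ℝ) (r : ℕ) : Matrix (Fin m) (Fin n) ℝ :=
  ∑ i : Fin k with i.val < r, σ i • Matrix.vecMulVec (fun a => P a i) (fun b => Q b i)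

/-- The best submodel optimality gap `𝓔(U, V, r)`: the minimum of `‖U Π_S Vᵀ - A_r‖_F ^ 2` over the
masks `S ⊆ [k]` with `|S| = r`. For `r ≤ k` this is an infimum over a finite nonempty family. -/
noncomputable def submodelGap {m n k : ℕ} (U : Matrix (Fin m) (Fin k) ℝ)
    (V : Matrix (Fin n) (Fin k) ℝ) (P : Matrix (Fin m) (Fin k) ℝ) (σ : Fin k → ℝ)
    (Q : Matrix (Fin n) (Fin k) ℝ) (r : ℕ) : ℝ :=
  ⨅ S : {S : Finset (Fin k) // S.card = r}, ‖U * mask S.1 * Vᵀ - truncatedSVD P σ Q r‖ ^ 2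

/-- The lower bound `(1 / k) (r λ - ∑_{i ≤ r} σ_i) ^ 2`, where `λ = (1 / k) ‖U Vᵀ‖_*`. -/
noncomputable def gapBound {m n k : ℕ} (U : Matrix (Fin m) (Fin k) ℝ)
    (V : Matrix (Fin n) (Fin k) ℝ) (σ : Fin k → ℝ) (r : ℕ) : ℝ :=
  1 / (k : ℝ) *
    ((r : ℝ) * (1 / (k : ℝ) * nuclearNorm (U * Vᵀ)) - ∑ i : Fin k with i.val < r, σ i) ^ 2

end ElasticLinear

namespace ElasticLinear

open Matrix Finset

/-! Write `X_l = u_l v_lᵀ`. Averaging over all masks (the empty one only adds a constant) turns the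
objective into `‖½UVᵀ - M‖² + ¼∑‖X_l‖²`: squared bias plus Bernoulli(½) variance. Choose `τ` with `∑
max (σ_i - τ) 0 = kτ` and split `M = Y + N`, where `Y` is the soft-thresholding of `M` and `N` has
singular values `min (σ_i) τ`. Then `meanObjective_eq_add` writes the objective as a constant plus
three nonnegative slacks. A balanced factorization of `2Y` makes all three vanish, so every
minimizer does too: `UVᵀ = 2Y`, `‖X_l‖ = 2τ`, `⟨N, X_l⟩ = 2τ²` (`IsASLMinimizer.structure`). Hence
`λ = 2τ`. For `|S| = r`, Cauchy–Schwarz against a test matrix bounds `‖∑_{l∈S} X_l - A_r‖` from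
below: `N` serves when `rλ ≥ ∑σ_i`, and `PQᵀ` otherwise. For `r < k` the bound vanishes only on
finitely many hyperplanes of spectra. At `r = k` it can vanish on an open set, so positivity of that
gap is proved directly: `2Y = M` would force all `σ_i` to be equal. -/

/-- The Frobenius inner product of two real matrices. -/
def frobInner {m n : ℕ} (A B : Matrix (Fin m) (Fin n) ℝ) : ℝ :=
  ∑ i, ∑ j, A i j * B i j

/-! ### Frobenius geometry and rank-one expansions -/

section Frobenius

variable {m n k : ℕ}

theorem frobenius_norm_sq (A : Matrix (Fin m) (Fin n) ℝ) : ‖A‖ ^ 2 = frobInner A A := by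
  have h0 : 0 ≤ ∑ i, ∑ j, A i j * A i j :=
    sum_nonneg fun i _ => sum_nonneg fun j _ => mul_self_nonneg _
  rw [Matrix.frobenius_norm_def, ← Real.sqrt_eq_rpow, Real.sq_sqrt]
  · simp [frobInner, sq]
  · positivity

theorem frobInner_sub_right (A B C : Matrix (Fin m) (Fin n) ℝ) :
    frobInner A (B - C) = frobInner A B - frobInner A C := by
  simp [frobInner, mul_sub, sum_sub_distrib]

theorem frobInner_sum_right {ι : Type*} (s : Finset ι) (A : Matrix (Fin m) (Fin n) ℝ)
    (B : ι → Matrix (Fin m) (Fin n) ℝ) :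
    frobInner A (∑ l ∈ s, B l) = ∑ l ∈ s, frobInner A (B l) := by
  simp only [frobInner, Matrix.sum_apply, mul_sum]
  rw [sum_comm (s := s)]
  exact sum_congr rfl fun i _ => sum_comm

theorem frobenius_norm_sub_sq (A B : Matrix (Fin m) (Fin n) ℝ) :
    ‖A - B‖ ^ 2 = ‖A‖ ^ 2 - 2 * frobInner A B + ‖B‖ ^ 2 := by
  simp only [frobenius_norm_sq, frobInner, Matrix.sub_apply, mul_sum, ← sum_sub_distrib,
    ← sum_add_distrib]
  exact sum_congr rfl fun i _ => sum_congr rfl fun j _ => by ring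

theorem frobInner_sq_le (A B : Matrix (Fin m) (Fin n) ℝ) :
    frobInner A B ^ 2 ≤ ‖A‖ ^ 2 * ‖B‖ ^ 2 := by
  simp only [frobenius_norm_sq, frobInner, ← sum_product']
  simpa only [sq] using sum_mul_sq_le_sq_mul_sq (univ ×ˢ univ)
    (fun x : Fin m × Fin n => A x.1 x.2) (fun x => B x.1 x.2)

theorem frobInner_vecMulVec (A : Matrix (Fin m) (Fin n) ℝ) (u : Fin m → ℝ) (v : Fin n → ℝ) :
    frobInner A (vecMulVec u v) = u ⬝ᵥ A *ᵥ v := by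
  simp only [frobInner, vecMulVec_apply, dotProduct, mulVec, mul_sum]
  exact sum_congr rfl fun i _ => sum_congr rfl fun j _ => by ring

theorem norm_vecMulVec_sq (u : Fin m → ℝ) (v : Fin n → ℝ) :
    ‖vecMulVec u v‖ ^ 2 = (u ⬝ᵥ u) * (v ⬝ᵥ v) := by
  rw [frobenius_norm_sq, frobInner_vecMulVec, vecMulVec_mulVec]
  simp [mul_comm]

theorem mul_transpose_eq_sum_vecMulVec (U : Matrix (Fin m) (Fin k) ℝ)
    (V : Matrix (Fin n) (Fin k) ℝ) :
    U * Vᵀ = ∑ l, vecMulVec (fun a => U a l) (fun b => V b l) := by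
  ext i j
  simp [Matrix.mul_apply, Matrix.sum_apply, vecMulVec_apply]

theorem mul_diagonal_mul_transpose_eq_sum (U : Matrix (Fin m) (Fin k) ℝ) (c : Fin k → ℝ)
    (V : Matrix (Fin n) (Fin k) ℝ) :
    U * diagonal c * Vᵀ = ∑ l, c l • vecMulVec (fun a => U a l) (fun b => V b l) := by
  rw [mul_transpose_eq_sum_vecMulVec]
  refine sum_congr rfl fun l _ => ?_
  ext i j
  simp only [vecMulVec_apply, mul_diagonal, Matrix.smul_apply, smul_eq_mul]
  ring

theorem mul_mask_mul_transpose_eq_sum (U : Matrix (Fin m) (Fin k) ℝ)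
    (V : Matrix (Fin n) (Fin k) ℝ) (S : Finset (Fin k)) :
    U * mask S * Vᵀ = ∑ l ∈ S, vecMulVec (fun a => U a l) (fun b => V b l) := by
  rw [mask, mul_diagonal_mul_transpose_eq_sum]
  simp [ite_smul]

theorem truncatedSVD_eq_mul_diagonal (P : Matrix (Fin m) (Fin k) ℝ) (σ : Fin k → ℝ)
    (Q : Matrix (Fin n) (Fin k) ℝ) (r : ℕ) :
    truncatedSVD P σ Q r = P * diagonal (fun i => if i.val < r then σ i else 0) * Qᵀ := by
  rw [mul_diagonal_mul_transpose_eq_sum, truncatedSVD, sum_filter]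
  simp [ite_smul]

/-- Bessel's inequality for the orthonormal columns of `P`. -/
theorem sum_sq_transpose_mulVec_le {P : Matrix (Fin m) (Fin k) ℝ} (hP : Pᵀ * P = 1)
    (u : Fin m → ℝ) : ∑ a, (Pᵀ *ᵥ u) a ^ 2 ≤ u ⬝ᵥ u := by
  have h := dotProduct_star_self_nonneg (u - P *ᵥ (Pᵀ *ᵥ u))
  have e1 : u ⬝ᵥ P *ᵥ (Pᵀ *ᵥ u) = (Pᵀ *ᵥ u) ⬝ᵥ (Pᵀ *ᵥ u) := by
    rw [dotProduct_mulVec, ← mulVec_transpose]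
  have e2 : (P *ᵥ (Pᵀ *ᵥ u)) ⬝ᵥ (P *ᵥ (Pᵀ *ᵥ u)) = (Pᵀ *ᵥ u) ⬝ᵥ (Pᵀ *ᵥ u) := by
    rw [dotProduct_mulVec, ← mulVec_transpose, mulVec_mulVec, hP, one_mulVec]
  simp only [star_trivial, dotProduct_sub, sub_dotProduct] at h
  rw [dotProduct_comm (P *ᵥ _) u, e1, e2] at h
  have e3 : ∑ a, (Pᵀ *ᵥ u) a ^ 2 = (Pᵀ *ᵥ u) ⬝ᵥ (Pᵀ *ᵥ u) := by simp [dotProduct, sq]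
  linarith

variable {P : Matrix (Fin m) (Fin k) ℝ} {Q : Matrix (Fin n) (Fin k) ℝ}

theorem frobInner_mul_diagonal_vecMulVec (c : Fin k → ℝ) (u : Fin m → ℝ) (v : Fin n → ℝ) :
    frobInner (P * diagonal c * Qᵀ) (vecMulVec u v) =
      ∑ a, c a * ((Pᵀ *ᵥ u) a * (Qᵀ *ᵥ v) a) := by
  rw [frobInner_vecMulVec, ← mulVec_mulVec, ← mulVec_mulVec, dotProduct_mulVec,
    ← mulVec_transpose]
  simp only [dotProduct, mulVec_diagonal]
  exact sum_congr rfl fun i _ => by ring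

/-- Operator norm against nuclear norm, which is the Frobenius norm at rank one: Cauchy–Schwarz in
the singular bases, then Bessel on each factor. -/
theorem frobInner_mul_diagonal_vecMulVec_le (hP : Pᵀ * P = 1) (hQ : Qᵀ * Q = 1)
    {c : Fin k → ℝ} {t : ℝ} (ht : 0 ≤ t) (hc : ∀ a, |c a| ≤ t) (u : Fin m → ℝ) (v : Fin n → ℝ) :
    frobInner (P * diagonal c * Qᵀ) (vecMulVec u v) ≤ t * ‖vecMulVec u v‖ := by
  rw [frobInner_mul_diagonal_vecMulVec]
  have h1 := sum_mul_sq_le_sq_mul_sq univ (fun a => |(Pᵀ *ᵥ u) a|) (fun a => |(Qᵀ *ᵥ v) a|)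
  simp only [sq_abs] at h1
  have h2 : (∑ a, |(Pᵀ *ᵥ u) a| * |(Qᵀ *ᵥ v) a|) ≤ ‖vecMulVec u v‖ := by
    refine abs_le_of_sq_le_sq' ?_ (norm_nonneg _) |>.2
    rw [norm_vecMulVec_sq]
    refine h1.trans (mul_le_mul (sum_sq_transpose_mulVec_le hP u)
      (sum_sq_transpose_mulVec_le hQ v) (sum_nonneg fun _ _ => sq_nonneg _) ?_)
    simpa using dotProduct_star_self_nonneg u
  calc _ ≤ ∑ a, t * (|(Pᵀ *ᵥ u) a| * |(Qᵀ *ᵥ v) a|) := by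
        refine sum_le_sum fun a _ => (le_abs_self _).trans ?_
        rw [abs_mul, abs_mul]
        exact mul_le_mul_of_nonneg_right (hc a) (by positivity)
    _ ≤ _ := by
        rw [← mul_sum]
        exact mul_le_mul_of_nonneg_left h2 ht

theorem transpose_mulVec_col (hP : Pᵀ * P = 1) (a : Fin k) :
    Pᵀ *ᵥ (fun i => P i a) = Pi.single a 1 := by
  ext b
  have := congrFun (congrFun hP b) a
  simp only [Matrix.mul_apply, Matrix.one_apply, transpose_apply] at this
  simp [mulVec, dotProduct, this, Pi.single_apply]

theorem frobInner_mul_diagonal (hP : Pᵀ * P = 1) (hQ : Qᵀ * Q = 1) (c d : Fin k → ℝ) :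
    frobInner (P * diagonal c * Qᵀ) (P * diagonal d * Qᵀ) = ∑ a, c a * d a := by
  have h : P * diagonal d * Qᵀ =
      ∑ l, vecMulVec (d l • fun a => P a l) (fun b => Q b l) := by
    rw [mul_diagonal_mul_transpose_eq_sum]
    exact sum_congr rfl fun l _ => (smul_vecMulVec _ _ _).symm
  rw [h, frobInner_sum_right]
  refine sum_congr rfl fun l _ => ?_
  rw [frobInner_mul_diagonal_vecMulVec, mulVec_smul, transpose_mulVec_col hP,
    transpose_mulVec_col hQ]
  rw [sum_eq_single l (fun b _ hb => by simp [hb]) (by simp)]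
  simp

theorem norm_mul_diagonal_sq (hP : Pᵀ * P = 1) (hQ : Qᵀ * Q = 1) (c : Fin k → ℝ) :
    ‖P * diagonal c * Qᵀ‖ ^ 2 = ∑ a, c a ^ 2 := by
  rw [frobenius_norm_sq, frobInner_mul_diagonal hP hQ]
  simp [sq]

end Frobenius

/-! ### The objective as squared bias plus variance -/

section Objective

/-- Second moment of a uniformly random subset sum: each element is kept with probability ½,
independently, and contributes variance `x l ^ 2 / 4`. -/
theorem sum_powerset_sum_sub_sq {ι : Type*} [DecidableEq ι] (s : Finset ι) (x : ι → ℝ) (y : ℝ) :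
    ∑ S ∈ s.powerset, (∑ l ∈ S, x l - y) ^ 2 =
      2 ^ s.card * ((1 / 2 * ∑ l ∈ s, x l - y) ^ 2 + 1 / 4 * ∑ l ∈ s, x l ^ 2) := by
  induction s using Finset.induction_on generalizing y with
  | empty => simp
  | insert a s ha ih =>
    rw [sum_powerset_insert ha]
    have : ∀ S ∈ s.powerset, (∑ l ∈ insert a S, x l - y) ^ 2 = (∑ l ∈ S, x l - (y - x a)) ^ 2 := by
      intro S hS
      rw [sum_insert fun h => ha (mem_powerset.mp hS h)]
      ring
    rw [sum_congr rfl this, ih, ih, sum_insert ha, sum_insert ha, card_insert_of_notMem ha]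
    ring

variable {m n k : ℕ}

/-- The objective obtained by averaging over all masks, the empty one included. -/
noncomputable def meanObjective (M : Matrix (Fin m) (Fin n) ℝ)
    (U : Matrix (Fin m) (Fin k) ℝ) (V : Matrix (Fin n) (Fin k) ℝ) : ℝ :=
  ‖(1 / 2 : ℝ) • (U * Vᵀ) - M‖ ^ 2 +
    1 / 4 * ∑ l, ‖vecMulVec (fun a => U a l) (fun b => V b l)‖ ^ 2

theorem sum_mask_eq_meanObjective (M : Matrix (Fin m) (Fin n) ℝ)
    (U : Matrix (Fin m) (Fin k) ℝ) (V : Matrix (Fin n) (Fin k) ℝ) :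
    ∑ S : Finset (Fin k), ‖U * mask S * Vᵀ - M‖ ^ 2 = 2 ^ k * meanObjective M U V := by
  have h := fun i j => sum_powerset_sum_sub_sq (univ : Finset (Fin k))
    (fun l => U i l * V j l) (M i j)
  simp only [powerset_univ, card_univ, Fintype.card_fin] at h
  simp_rw [meanObjective, mul_mask_mul_transpose_eq_sum, mul_transpose_eq_sum_vecMulVec,
    frobenius_norm_sq, frobInner]
  simp only [Matrix.sub_apply, Matrix.sum_apply, vecMulVec_apply, Matrix.smul_apply, smul_eq_mul,
    ← sq]
  rw [sum_comm]
  simp_rw [sum_comm (s := (univ : Finset (Finset (Fin k)))), h]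
  rw [sum_comm (s := (univ : Finset (Fin k)))]
  simp_rw [sum_comm (s := (univ : Finset (Fin k))), mul_sum (s := (univ : Finset (Fin m))),
    mul_sum (s := (univ : Finset (Fin n))), ← sum_add_distrib]
  simp_rw [mul_sum (s := (univ : Finset (Fin m))), mul_sum (s := (univ : Finset (Fin n)))]

/-- The empty mask contributes `‖M‖ ^ 2` whatever `U` and `V` are, so including it leaves the
minimizers unchanged. -/
theorem aslObjective_eq (M : Matrix (Fin m) (Fin n) ℝ)
    (U : Matrix (Fin m) (Fin k) ℝ) (V : Matrix (Fin n) (Fin k) ℝ) :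
    aslObjective M U V =
      1 / ((2 : ℝ) ^ k - 1) * (2 ^ k * meanObjective M U V - ‖M‖ ^ 2) := by
  have h : (univ.filter fun S : Finset (Fin k) => S.Nonempty) = univ.erase ∅ := by
    ext S
    simp [nonempty_iff_ne_empty]
  rw [aslObjective, h, ← sum_mask_eq_meanObjective, ← add_sum_erase univ _ (mem_univ ∅),
    mul_mask_mul_transpose_eq_sum]
  simp

theorem IsASLMinimizer.meanObjective_le {M : Matrix (Fin m) (Fin n) ℝ}
    {U : Matrix (Fin m) (Fin k) ℝ} {V : Matrix (Fin n) (Fin k) ℝ} (h : IsASLMinimizer M U V)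
    (hk : 0 < k) (U' : Matrix (Fin m) (Fin k) ℝ) (V' : Matrix (Fin n) (Fin k) ℝ) :
    meanObjective M U V ≤ meanObjective M U' V' := by
  have h2 : (1 : ℝ) < 2 ^ k := one_lt_pow₀ (by norm_num) hk.ne'
  have := h U' V'
  rw [aslObjective_eq, aslObjective_eq] at this
  have := le_of_mul_le_mul_left this (one_div_pos.mpr (sub_pos.mpr h2))
  exact le_of_mul_le_mul_left (by linarith) (zero_lt_one.trans h2)

end Objective

end ElasticLinear

namespace ElasticLinear

open Matrix Finset

/-! ### Factorizations with rank-one terms of equal norm -/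

section Balancing

variable {k : ℕ}

/-- The rotation by the angle `θ` of the columns `i` and `j` of `O`. -/
noncomputable def rotateCols (O : Matrix (Fin k) (Fin k) ℝ) (i j : Fin k) (θ : ℝ) :
    Matrix (Fin k) (Fin k) ℝ := fun a l =>
  if l = i then Real.cos θ * O a i + Real.sin θ * O a j
  else if l = j then -Real.sin θ * O a i + Real.cos θ * O a j
  else O a l

theorem rotateCols_mul_transpose (O : Matrix (Fin k) (Fin k) ℝ) {i j : Fin k} (hij : i ≠ j)
    (θ : ℝ) : rotateCols O i j θ * (rotateCols O i j θ)ᵀ = O * Oᵀ := by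
  ext a b
  simp only [Matrix.mul_apply, transpose_apply]
  rw [← sub_eq_zero, ← sum_sub_distrib]
  rw [← sum_subset (subset_univ {i, j}) (fun l _ hl => ?_)]
  · rw [sum_pair hij]
    simp only [rotateCols, if_true, if_neg hij.symm]
    linear_combination (O a i * O b i + O a j * O b j) * Real.cos_sq_add_sin_sq θ
  · simp only [mem_insert, mem_singleton, not_or] at hl
    simp [rotateCols, hl.1, hl.2]

theorem sum_weighted_sq_eq {O : Matrix (Fin k) (Fin k) ℝ} (hO : O * Oᵀ = 1) (d : Fin k → ℝ) :
    ∑ l, ∑ a, d a * O a l ^ 2 = ∑ a, d a := by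
  rw [sum_comm]
  refine sum_congr rfl fun a _ => ?_
  have := congrFun (congrFun hO a) a
  simp only [Matrix.mul_apply, transpose_apply, Matrix.one_apply, if_true] at this
  rw [← mul_sum]
  simp [sq, this]

/-- Every diagonal matrix is orthogonally similar to one with constant diagonal. -/
theorem exists_orthogonal_constant_diag (hk : 0 < k) (d : Fin k → ℝ) :
    ∃ O : Matrix (Fin k) (Fin k) ℝ, O * Oᵀ = 1 ∧
      ∀ l, ∑ a, d a * O a l ^ 2 = (∑ a, d a) / k := by
  set μ : ℝ := (∑ a, d a) / k with hμ
  have hk0 : (k : ℝ) ≠ 0 := by positivity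
  -- Strong induction on the number of columns whose diagonal entry of `Oᵀ diag(d) O` differs from
  -- the mean.
  suffices H : ∀ N : ℕ, ∀ O : Matrix (Fin k) (Fin k) ℝ, O * Oᵀ = 1 →
      (univ.filter fun l => ∑ a, d a * O a l ^ 2 ≠ μ).card = N →
      ∃ O : Matrix (Fin k) (Fin k) ℝ, O * Oᵀ = 1 ∧ ∀ l, ∑ a, d a * O a l ^ 2 = μ from
    H _ 1 (by simp) rfl
  intro N
  induction N using Nat.strong_induction_on with
  | _ N ih =>
  intro O hO hN
  by_cases hall : ∀ l, ∑ a, d a * O a l ^ 2 = μ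
  · exact ⟨O, hO, hall⟩
  have hsum : ∑ l, ∑ a, d a * O a l ^ 2 = ∑ _l : Fin k, μ := by
    rw [sum_weighted_sq_eq hO, sum_const, card_univ, Fintype.card_fin, nsmul_eq_mul, hμ]
    field_simp
  push Not at hall
  obtain ⟨l₀, hl₀⟩ := hall
  obtain ⟨i, hi⟩ : ∃ i, ∑ a, d a * O a i ^ 2 < μ := by
    by_contra! h
    exact hl₀ ((sum_eq_sum_iff_of_le fun l _ => h l).mp hsum.symm l₀ (mem_univ _)).symm
  obtain ⟨j, hj⟩ : ∃ j, μ < ∑ a, d a * O a j ^ 2 := by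
    by_contra! h
    exact hl₀ ((sum_eq_sum_iff_of_le fun l _ => h l).mp hsum l₀ (mem_univ _))
  have hij : i ≠ j := by
    rintro rfl
    exact lt_asymm hi hj
  -- The rotated entry is that of column `i` (below `μ`) at angle `0` and that of column `j` (above
  -- `μ`) at `π / 2`. Column `i` gets repaired and only `j`, already off the mean, is disturbed.
  obtain ⟨θ, -, hθ⟩ : μ ∈ (fun θ => ∑ a, d a * (Real.cos θ * O a i + Real.sin θ * O a j) ^ 2) ''
      Set.Icc 0 (Real.pi / 2) := by
    refine intermediate_value_Icc (by positivity) (by fun_prop) ⟨?_, ?_⟩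
    · simpa using hi.le
    · simpa using hj.le
  refine ih _ ?_ (rotateCols O i j θ) (by rw [rotateCols_mul_transpose O hij, hO]) rfl
  rw [← hN]
  refine card_lt_card ⟨fun l hl => ?_, fun h => ?_⟩
  · simp only [mem_filter, mem_univ, true_and] at hl ⊢
    by_cases hli : l = i
    · exact hli ▸ hi.ne
    by_cases hlj : l = j
    · exact hlj ▸ hj.ne'
    simpa [rotateCols, hli, hlj] using hl
  · refine (mem_filter.mp (h (mem_filter.mpr ⟨mem_univ i, hi.ne⟩))).2 ?_
    simpa [rotateCols] using hθ

variable {m n : ℕ}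

/-- A matrix with singular values `d` has a factorization into `k` rank-one terms, all of the same
Frobenius norm, the mean of `d`. -/
theorem exists_balanced_factorization (hk : 0 < k) {P : Matrix (Fin m) (Fin k) ℝ}
    {Q : Matrix (Fin n) (Fin k) ℝ} (hP : Pᵀ * P = 1) (hQ : Qᵀ * Q = 1) {d : Fin k → ℝ}
    (hd : ∀ a, 0 ≤ d a) :
    ∃ (U : Matrix (Fin m) (Fin k) ℝ) (V : Matrix (Fin n) (Fin k) ℝ),
      U * Vᵀ = P * diagonal d * Qᵀ ∧
      ∀ l, ‖vecMulVec (fun a => U a l) (fun b => V b l)‖ ^ 2 = ((∑ a, d a) / k) ^ 2 := by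
  obtain ⟨O, hO, hdiag⟩ := exists_orthogonal_constant_diag hk d
  have hcol : ∀ {N : ℕ} {R : Matrix (Fin N) (Fin k) ℝ}, Rᵀ * R = 1 → ∀ l,
      (fun a => (R * (diagonal (fun i => √(d i)) * O)) a l) ⬝ᵥ
        (fun a => (R * (diagonal (fun i => √(d i)) * O)) a l) = (∑ a, d a) / k := by
    intro N R hR l
    set C := diagonal (fun i => √(d i)) * O with hC
    have e : (R * C)ᵀ * (R * C) = Cᵀ * C := by
      rw [transpose_mul, Matrix.mul_assoc, ← Matrix.mul_assoc Rᵀ, hR, Matrix.one_mul]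
    have := congrFun (congrFun e l) l
    rw [Matrix.mul_apply, Matrix.mul_apply] at this
    simp only [transpose_apply] at this
    rw [dotProduct, this, ← hdiag l]
    refine sum_congr rfl fun a _ => ?_
    rw [hC, diagonal_mul]
    linear_combination O a l ^ 2 * Real.mul_self_sqrt (hd a)
  -- With `√D O` in both factors, the `l`-th columns of `U` and `V` both have squared norm `(Oᵀ D
  -- O)_{ll}`, the mean of `d`.
  refine ⟨P * (diagonal (fun i => √(d i)) * O), Q * (diagonal (fun i => √(d i)) * O), ?_, ?_⟩
  · rw [transpose_mul, transpose_mul, diagonal_transpose]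
    have : diagonal d = diagonal (fun i => √(d i)) * (O * Oᵀ) * diagonal (fun i => √(d i)) := by
      rw [hO, Matrix.mul_one, diagonal_mul_diagonal]
      congr 1
      ext i
      exact (Real.mul_self_sqrt (hd i)).symm
    rw [this]
    simp only [Matrix.mul_assoc]
  · intro l
    rw [norm_vecMulVec_sq, hcol hP, hcol hQ, sq]

end Balancing

/-! ### Nuclear norm from an explicit decomposition -/

section NuclearNorm

variable {m n k : ℕ}

open Polynomial in
theorem nuclearNorm_mul_diagonal {P : Matrix (Fin m) (Fin k) ℝ}
    {Q : Matrix (Fin n) (Fin k) ℝ} (hP : Pᵀ * P = 1) (hQ : Qᵀ * Q = 1) {d : Fin k → ℝ}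
    (hd : ∀ a, 0 ≤ d a) : nuclearNorm (P * diagonal d * Qᵀ) = ∑ a, d a := by
  set W := P * diagonal d * Qᵀ with hW
  set T := Matrix.toEuclideanLin W with hT
  have hfin : Module.finrank ℝ (EuclideanSpace ℝ (Fin n)) = n := by simp
  have hroots := T.isSymmetric_adjoint_comp_self.roots_charpoly_eq_eigenvalues hfin
  have hcomp : LinearMap.adjoint T ∘ₗ T = Matrix.toEuclideanLin (Wᵀ * W) := by
    rw [hT, ← Matrix.toEuclideanLin_conjTranspose_eq_adjoint, conjTranspose_eq_transpose_of_trivial]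
    ext x i
    simp [Matrix.toLpLin_apply]
  have hchar : (LinearMap.adjoint T ∘ₗ T).charpoly = (Wᵀ * W).charpoly := by
    rw [hcomp, Matrix.toEuclideanLin, Matrix.toLpLin_eq_toLin, Matrix.charpoly_toLin]
  have hWW : Wᵀ * W = Q * (diagonal (fun a => d a ^ 2) * Qᵀ) := by
    rw [hW, transpose_mul, transpose_mul, transpose_transpose, diagonal_transpose,
      Matrix.mul_assoc, Matrix.mul_assoc, ← Matrix.mul_assoc Pᵀ, ← Matrix.mul_assoc Pᵀ, hP,
      Matrix.one_mul, ← Matrix.mul_assoc (diagonal d), diagonal_mul_diagonal]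
    simp [sq]
  -- Swapping the factors of `WᵀW = Q (D² Qᵀ)` gives `D²`, up to powers of `X`. The extra zero roots
  -- do not affect the sum of square roots of the roots.
  have hpoly : X ^ k * (Wᵀ * W).charpoly = X ^ n * ∏ a, (X - C (d a ^ 2)) := by
    have := Matrix.charpoly_mul_comm' Q (diagonal (fun a => d a ^ 2) * Qᵀ)
    rw [Matrix.mul_assoc, hQ, Matrix.mul_one, charpoly_diagonal] at this
    simpa [hWW] using this
  have hr := congrArg (fun p => (p.roots.map Real.sqrt).sum) hpoly
  have hne : (∏ a, (X - C (d a ^ 2)) : ℝ[X]) ≠ 0 :=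
    prod_ne_zero_iff.mpr fun a _ => X_sub_C_ne_zero _
  rw [roots_mul (mul_ne_zero (pow_ne_zero _ X_ne_zero) (Matrix.charpoly_monic _).ne_zero),
    roots_mul (mul_ne_zero (pow_ne_zero _ X_ne_zero) hne), roots_prod _ _ hne, ← hchar,
    hroots] at hr
  simp [Multiset.map_nsmul, Multiset.sum_nsmul, List.sum_ofFn, Real.sqrt_sq (hd _), -map_pow] at hr
  rw [nuclearNorm, sum_range]
  simp_rw [LinearMap.singularValues_fin _ hfin]
  exact hr

end NuclearNorm

/-! ### The soft threshold -/

section Threshold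

variable {k : ℕ}

/-- Intermediate values between `0` and `∑ σ_i`. The equation says that the `k` equal rank-one norms
of a balanced `2Y` are `2τ`, which is what kills the variance slack. -/
theorem exists_threshold (hk : 0 < k) {σ : Fin k → ℝ} (hσ : ∀ i, 0 < σ i) :
    ∃ τ : ℝ, 0 < τ ∧ ∑ i, max (σ i - τ) 0 = k * τ := by
  have hk' : (0 : ℝ) < k := by exact_mod_cast hk
  have hne : (univ : Finset (Fin k)).Nonempty := ⟨⟨0, hk⟩, mem_univ _⟩
  have hpos : 0 < ∑ i, σ i := sum_pos (fun i _ => hσ i) hne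
  obtain ⟨τ, hτ, h⟩ : (0 : ℝ) ∈ (fun τ : ℝ => ∑ i, max (σ i - τ) 0 - k * τ) ''
      Set.Icc 0 (∑ i, σ i) := by
    refine intermediate_value_Icc' hpos.le (by fun_prop) ⟨?_, ?_⟩
    · have : ∑ i, max (σ i - ∑ j, σ j) 0 = 0 := sum_eq_zero fun i hi =>
        max_eq_right (sub_nonpos.mpr (single_le_sum (fun j _ => (hσ j).le) hi))
      rw [this]
      nlinarith
    · simp only [sub_zero, mul_zero]
      exact sum_nonneg fun i _ => le_max_right _ _
  simp only at h
  refine ⟨τ, lt_of_le_of_ne hτ.1 ?_, by linarith⟩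
  rintro rfl
  have : ∑ i, max (σ i - 0) 0 = ∑ i, σ i :=
    sum_congr rfl fun i _ => by rw [sub_zero, max_eq_left (hσ i).le]
  rw [this] at h
  linarith

end Threshold

end ElasticLinear

namespace ElasticLinear

open Matrix Finset

/-! ### Exact description of the minimizers -/

section Minimizer

variable {m n k : ℕ} {M : Matrix (Fin m) (Fin n) ℝ} {P : Matrix (Fin m) (Fin k) ℝ}
  {σ : Fin k → ℝ} {Q : Matrix (Fin n) (Fin k) ℝ} {τ : ℝ}

/-- Completing squares around `Y`, using `⟨N, Y⟩ = kτ²`, which holds because `N` has singular value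
`τ` wherever `Y` is nonzero. The last sum is nonnegative since `‖N‖_op ≤ τ`. -/
theorem meanObjective_eq_add (h : IsSimpleSVD M P σ Q)
    (hτ : ∑ i, max (σ i - τ) 0 = k * τ) (U : Matrix (Fin m) (Fin k) ℝ)
    (V : Matrix (Fin n) (Fin k) ℝ) :
    meanObjective M U V =
      ‖P * diagonal (fun i => min (σ i) τ) * Qᵀ‖ ^ 2 + k * τ ^ 2 +
      ‖(1 / 2 : ℝ) • (U * Vᵀ) - P * diagonal (fun i => max (σ i - τ) 0) * Qᵀ‖ ^ 2 +
      ∑ l, (1 / 2 * ‖vecMulVec (fun a => U a l) (fun b => V b l)‖ - τ) ^ 2 +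
      ∑ l, (τ * ‖vecMulVec (fun a => U a l) (fun b => V b l)‖ -
        frobInner (P * diagonal (fun i => min (σ i) τ) * Qᵀ)
          (vecMulVec (fun a => U a l) (fun b => V b l))) := by
  set N := P * diagonal (fun i => min (σ i) τ) * Qᵀ with hN
  set Y := P * diagonal (fun i => max (σ i - τ) 0) * Qᵀ with hY
  have hM : M = Y + N := by
    rw [h.eq_mul, hY, hN, ← Matrix.add_mul, ← Matrix.mul_add, diagonal_add]
    congr 3
    ext i
    rcases le_total (σ i) τ with hi | hi
    · simp [hi]
    · simp [hi]
  have hNY : frobInner N Y = k * τ ^ 2 := by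
    rw [hN, hY, frobInner_mul_diagonal h.left_orthonormal h.right_orthonormal, sq, ← mul_assoc,
      ← hτ, sum_mul]
    refine sum_congr rfl fun i _ => ?_
    rcases le_total (σ i) τ with hi | hi
    · simp [hi]
    · simp [hi, mul_comm]
  have hNW : frobInner N ((1 / 2 : ℝ) • (U * Vᵀ)) =
      1 / 2 * ∑ l, frobInner N (vecMulVec (fun a => U a l) (fun b => V b l)) := by
    rw [← frobInner_sum_right, ← mul_transpose_eq_sum_vecMulVec]
    simp only [frobInner, Matrix.smul_apply, smul_eq_mul, mul_sum]
    exact sum_congr rfl fun i _ => sum_congr rfl fun j _ => by ring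
  have hsplit : ‖(1 / 2 : ℝ) • (U * Vᵀ) - M‖ ^ 2 = ‖N‖ ^ 2 -
      2 * (frobInner N ((1 / 2 : ℝ) • (U * Vᵀ)) - frobInner N Y) +
      ‖(1 / 2 : ℝ) • (U * Vᵀ) - Y‖ ^ 2 := by
    rw [← frobInner_sub_right, ← frobenius_norm_sub_sq, hM, ← norm_sub_rev]
    congr 2
    abel
  have hsq : ∑ l, (1 / 2 * ‖vecMulVec (fun a => U a l) (fun b => V b l)‖ - τ) ^ 2 =
      1 / 4 * ∑ l, ‖vecMulVec (fun a => U a l) (fun b => V b l)‖ ^ 2 -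
      τ * ∑ l, ‖vecMulVec (fun a => U a l) (fun b => V b l)‖ + k * τ ^ 2 := by
    have : (k : ℝ) * τ ^ 2 = ∑ _l : Fin k, τ ^ 2 := by simp
    rw [this, mul_sum, mul_sum, ← sum_sub_distrib, ← sum_add_distrib]
    exact sum_congr rfl fun l _ => by ring
  rw [meanObjective, hsplit, hsq, hNW, hNY, sum_sub_distrib, ← mul_sum]
  ring

/-- The minimizers of the ASL objective: the product is twice the soft-thresholding of the target,
all the rank-one terms have the same norm, and they are aligned with the dual certificate. -/
theorem IsASLMinimizer.structure (hk : 0 < k) (h : IsSimpleSVD M P σ Q) (hτ0 : 0 < τ)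
    (hτ : ∑ i, max (σ i - τ) 0 = k * τ) {U : Matrix (Fin m) (Fin k) ℝ}
    {V : Matrix (Fin n) (Fin k) ℝ} (hUV : IsASLMinimizer M U V) :
    U * Vᵀ = P * diagonal (fun i => 2 * max (σ i - τ) 0) * Qᵀ ∧
    ∀ l, ‖vecMulVec (fun a => U a l) (fun b => V b l)‖ = 2 * τ ∧
      frobInner (P * diagonal (fun i => min (σ i) τ) * Qᵀ)
        (vecMulVec (fun a => U a l) (fun b => V b l)) = 2 * τ ^ 2 := by
  have hk' : (0 : ℝ) < k := by exact_mod_cast hk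
  have hdouble : P * diagonal (fun i => 2 * max (σ i - τ) 0) * Qᵀ =
      (2 : ℝ) • (P * diagonal (fun i => max (σ i - τ) 0) * Qᵀ) := by
    rw [← Matrix.smul_mul, ← Matrix.mul_smul, ← diagonal_smul]
    rfl
  obtain ⟨U', V', hW', hX'⟩ := exists_balanced_factorization hk h.left_orthonormal
    h.right_orthonormal (d := fun i => 2 * max (σ i - τ) 0) (fun i => by positivity)
  have hmin := hUV.meanObjective_le hk U' V'
  have hval : meanObjective M U' V' =
      ‖P * diagonal (fun i => min (σ i) τ) * Qᵀ‖ ^ 2 + k * τ ^ 2 := by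
    have hM : (1 / 2 : ℝ) • (U' * V'ᵀ) - M =
        -(P * diagonal (fun i => min (σ i) τ) * Qᵀ) := by
      rw [hW', hdouble, smul_smul, h.eq_mul, ← Matrix.neg_mul, ← Matrix.mul_neg]
      norm_num
      rw [← Matrix.sub_mul, ← Matrix.mul_sub, diagonal_sub]
      congr 3
      ext i
      rcases le_total (σ i) τ with hi | hi
      · simp [hi]
      · simp [hi]
    rw [meanObjective, hM, norm_neg]
    simp_rw [hX']
    rw [← mul_sum, hτ, sum_const, card_univ, Fintype.card_fin, nsmul_eq_mul]
    field_simp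
    ring
  rw [hval, meanObjective_eq_add h hτ] at hmin
  have halign : ∀ l, frobInner (P * diagonal (fun i => min (σ i) τ) * Qᵀ)
      (vecMulVec (fun a => U a l) (fun b => V b l)) ≤
      τ * ‖vecMulVec (fun a => U a l) (fun b => V b l)‖ := fun l =>
    frobInner_mul_diagonal_vecMulVec_le h.left_orthonormal h.right_orthonormal hτ0.le
      (fun i => by rw [abs_of_pos (lt_min (h.pos i) hτ0)]; exact min_le_right _ _) _ _
  have hsum1 := sum_nonneg fun l (_ : l ∈ univ) =>
    sq_nonneg (1 / 2 * ‖vecMulVec (fun a => U a l) (fun b => V b l)‖ - τ)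
  have hsum2 := sum_nonneg fun l (_ : l ∈ univ) => sub_nonneg.mpr (halign l)
  have hnn := sq_nonneg
    ‖(1 / 2 : ℝ) • (U * Vᵀ) - P * diagonal (fun i => max (σ i - τ) 0) * Qᵀ‖
  refine ⟨?_, fun l => ?_⟩
  · have h0 : ‖(1 / 2 : ℝ) • (U * Vᵀ) - P * diagonal (fun i => max (σ i - τ) 0) * Qᵀ‖ = 0 :=
      pow_eq_zero_iff two_ne_zero |>.mp (le_antisymm (by linarith) hnn)
    rw [hdouble, ← sub_eq_zero.mp (norm_eq_zero.mp h0), smul_smul]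
    norm_num
  · have e1 := (sum_eq_zero_iff_of_nonneg fun l (_ : l ∈ univ) =>
      sq_nonneg (1 / 2 * ‖vecMulVec (fun a => U a l) (fun b => V b l)‖ - τ)).mp
      (le_antisymm (by linarith) hsum1) l (mem_univ l)
    have e2 := (sum_eq_zero_iff_of_nonneg fun l (_ : l ∈ univ) =>
      sub_nonneg.mpr (halign l)).mp (le_antisymm (by linarith) hsum2) l (mem_univ l)
    have e3 := pow_eq_zero_iff two_ne_zero |>.mp e1
    have e4 : ‖vecMulVec (fun a => U a l) (fun b => V b l)‖ = 2 * τ := by linarith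
    refine ⟨e4, ?_⟩
    rw [e4] at e2
    linarith

theorem IsASLMinimizer.gapBound_eq (hk : 0 < k) (h : IsSimpleSVD M P σ Q) (hτ0 : 0 < τ)
    (hτ : ∑ i, max (σ i - τ) 0 = k * τ) {U : Matrix (Fin m) (Fin k) ℝ}
    {V : Matrix (Fin n) (Fin k) ℝ} (hUV : IsASLMinimizer M U V) (r : ℕ) :
    gapBound U V σ r = 1 / (k : ℝ) * (2 * r * τ - ∑ i : Fin k with i.val < r, σ i) ^ 2 := by
  have hk' : (k : ℝ) ≠ 0 := by positivity
  rw [gapBound, (hUV.structure hk h hτ0 hτ).1,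
    nuclearNorm_mul_diagonal h.left_orthonormal h.right_orthonormal (fun i => by positivity),
    ← mul_sum, hτ]
  congr 3
  field_simp

/-! ### The lower bound by test matrices -/

theorem sq_le_mul_of_frobInner {N D : Matrix (Fin m) (Fin n) ℝ} {t x : ℝ} (ht : 0 < t)
    (hN : ‖N‖ ^ 2 ≤ k * t ^ 2) (hx : 0 ≤ x) (h : t * x ≤ |frobInner N D|) :
    x ^ 2 ≤ k * ‖D‖ ^ 2 := by
  have h1 : (t * x) ^ 2 ≤ ‖N‖ ^ 2 * ‖D‖ ^ 2 :=
    (pow_le_pow_left₀ (by positivity) h 2).trans (by rw [sq_abs]; exact frobInner_sq_le N D)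
  have h2 : ‖N‖ ^ 2 * ‖D‖ ^ 2 ≤ k * t ^ 2 * ‖D‖ ^ 2 :=
    mul_le_mul_of_nonneg_right hN (sq_nonneg _)
  refine le_of_mul_le_mul_left (a := t ^ 2) ?_ (by positivity)
  calc t ^ 2 * x ^ 2 = (t * x) ^ 2 := by ring
    _ ≤ k * t ^ 2 * ‖D‖ ^ 2 := h1.trans h2
    _ = _ := by ring

theorem norm_mul_diagonal_sq_le (hP : Pᵀ * P = 1) (hQ : Qᵀ * Q = 1) {c : Fin k → ℝ} {t : ℝ}
    (hc : ∀ i, |c i| ≤ t) : ‖P * diagonal c * Qᵀ‖ ^ 2 ≤ k * t ^ 2 := by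
  rw [norm_mul_diagonal_sq hP hQ]
  calc ∑ a, c a ^ 2 ≤ ∑ _a : Fin k, t ^ 2 := sum_le_sum fun a _ =>
        sq_le_sq' (abs_le.mp (hc a)).1 (abs_le.mp (hc a)).2
    _ = _ := by simp

theorem frobInner_polar_vecMulVec_le (h : IsSimpleSVD M P σ Q) (u : Fin m → ℝ) (v : Fin n → ℝ) :
    frobInner (P * diagonal (fun _ : Fin k => (1 : ℝ)) * Qᵀ) (vecMulVec u v) ≤ ‖vecMulVec u v‖ := by
  have := frobInner_mul_diagonal_vecMulVec_le h.left_orthonormal h.right_orthonormal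
    (zero_le_one' ℝ) (c := fun _ => 1) (fun _ => abs_one.le) u v
  rwa [one_mul] at this

theorem frobInner_submodel_sub (h : IsSimpleSVD M P σ Q) (U : Matrix (Fin m) (Fin k) ℝ)
    (V : Matrix (Fin n) (Fin k) ℝ) (S : Finset (Fin k)) (r : ℕ) (c : Fin k → ℝ) :
    frobInner (P * diagonal c * Qᵀ) (U * mask S * Vᵀ - truncatedSVD P σ Q r) =
      ∑ l ∈ S, frobInner (P * diagonal c * Qᵀ) (vecMulVec (fun a => U a l) (fun b => V b l)) -
      ∑ i : Fin k with i.val < r, c i * σ i := by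
  rw [frobInner_sub_right, mul_mask_mul_transpose_eq_sum, frobInner_sum_right,
    truncatedSVD_eq_mul_diagonal,
    frobInner_mul_diagonal h.left_orthonormal h.right_orthonormal, sum_filter]
  simp

theorem IsASLMinimizer.gapBound_le_submodel (hk : 0 < k) (h : IsSimpleSVD M P σ Q)
    {U : Matrix (Fin m) (Fin k) ℝ} {V : Matrix (Fin n) (Fin k) ℝ} (hUV : IsASLMinimizer M U V)
    (S : Finset (Fin k)) :
    gapBound U V σ S.card ≤ ‖U * mask S * Vᵀ - truncatedSVD P σ Q S.card‖ ^ 2 := by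
  have hk' : (0 : ℝ) < k := by exact_mod_cast hk
  obtain ⟨τ, hτ0, hτ⟩ := exists_threshold hk h.pos
  obtain ⟨-, hX⟩ := hUV.structure hk h hτ0 hτ
  rw [hUV.gapBound_eq hk h hτ0 hτ, one_div, inv_mul_le_iff₀ hk']
  set r := S.card with hr
  set D := U * mask S * Vᵀ - truncatedSVD P σ Q r with hD
  -- Alignment gives the exact value `⟨N, X_l⟩ = 2τ²`, hence a lower bound on `⟨N, D⟩`. In the other
  -- case only the upper bound `⟨PQᵀ, X_l⟩ ≤ 2τ` is needed.
  rcases le_total (∑ i : Fin k with i.val < r, σ i) (2 * r * τ) with hle | hle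
  · refine sq_le_mul_of_frobInner (N := P * diagonal (fun i => min (σ i) τ) * Qᵀ) hτ0
      (norm_mul_diagonal_sq_le h.left_orthonormal h.right_orthonormal fun i => ?_)
      (sub_nonneg.mpr hle) (le_trans ?_ (le_abs_self _))
    · rw [abs_of_pos (lt_min (h.pos i) hτ0)]
      exact min_le_right _ _
    · rw [hD, frobInner_submodel_sub h, sum_congr rfl fun l _ => (hX l).2, sum_const,
        nsmul_eq_mul]
      have : ∑ i : Fin k with i.val < r, min (σ i) τ * σ i ≤
          τ * ∑ i : Fin k with i.val < r, σ i := by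
        rw [mul_sum]
        exact sum_le_sum fun i _ => mul_le_mul_of_nonneg_right (min_le_right _ _) (h.pos i).le
      linarith
  · rw [← neg_sq, neg_sub]
    refine sq_le_mul_of_frobInner (N := P * diagonal (fun _ : Fin k => (1 : ℝ)) * Qᵀ) one_pos
      (norm_mul_diagonal_sq_le h.left_orthonormal h.right_orthonormal fun i => by simp)
      (sub_nonneg.mpr hle) (le_trans ?_ (neg_le_abs _))
    have : ∑ l ∈ S, frobInner (P * diagonal (fun _ : Fin k => (1 : ℝ)) * Qᵀ)
        (vecMulVec (fun a => U a l) (fun b => V b l)) ≤ ∑ l ∈ S, 2 * τ :=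
      sum_le_sum fun l _ => (frobInner_polar_vecMulVec_le h _ _).trans (hX l).1.le
    rw [sum_const, nsmul_eq_mul] at this
    rw [hD, frobInner_submodel_sub h]
    simp only [one_mul]
    linarith

theorem le_submodelGap {U : Matrix (Fin m) (Fin k) ℝ} {V : Matrix (Fin n) (Fin k) ℝ} {r : ℕ}
    (hr : r ≤ k) {x : ℝ}
    (hx : ∀ S : Finset (Fin k), S.card = r → x ≤ ‖U * mask S * Vᵀ - truncatedSVD P σ Q r‖ ^ 2) :
    x ≤ submodelGap U V P σ Q r := by
  obtain ⟨S, -, hS⟩ := exists_subset_card_eq (s := (univ : Finset (Fin k))) (n := r) (by simpa)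
  have : Nonempty {S : Finset (Fin k) // S.card = r} := ⟨⟨S, hS⟩⟩
  exact le_ciInf fun S => hx S.1 S.2

theorem IsASLMinimizer.gapBound_le_submodelGap (h : IsSimpleSVD M P σ Q)
    {U : Matrix (Fin m) (Fin k) ℝ} {V : Matrix (Fin n) (Fin k) ℝ} (hUV : IsASLMinimizer M U V)
    {r : ℕ} (hr : 1 ≤ r) (hrk : r ≤ k) : gapBound U V σ r ≤ submodelGap U V P σ Q r :=
  le_submodelGap hrk fun S hS => hS ▸ hUV.gapBound_le_submodel (hr.trans hrk) h S

/-- A minimizer never reproduces the target, so the gap of the full model is positive. -/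
theorem IsASLMinimizer.submodelGap_self_pos (hk : 2 ≤ k) (h : IsSimpleSVD M P σ Q)
    {U : Matrix (Fin m) (Fin k) ℝ} {V : Matrix (Fin n) (Fin k) ℝ} (hUV : IsASLMinimizer M U V) :
    0 < submodelGap U V P σ Q k := by
  obtain ⟨τ, hτ0, hτ⟩ := exists_threshold (zero_lt_two.trans_le hk) h.pos
  obtain ⟨hW, -⟩ := hUV.structure (zero_lt_two.trans_le hk) h hτ0 hτ
  have hval : ∀ S : Finset (Fin k), S.card = k →
      ‖U * mask S * Vᵀ - truncatedSVD P σ Q k‖ ^ 2 =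
        ∑ i, (2 * max (σ i - τ) 0 - σ i) ^ 2 := by
    intro S hS
    obtain rfl : S = univ := (card_eq_iff_eq_univ S).mp (by simpa using hS)
    have hmask : mask (univ : Finset (Fin k)) = 1 := by simp [mask]
    rw [hmask, Matrix.mul_one, hW, truncatedSVD_eq_mul_diagonal]
    simp only [Fin.is_lt, if_true]
    rw [← Matrix.sub_mul, ← Matrix.mul_sub, diagonal_sub,
      norm_mul_diagonal_sq h.left_orthonormal h.right_orthonormal]
  refine lt_of_lt_of_le ?_ (le_submodelGap le_rfl fun S hS => (hval S hS).ge)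
  refine lt_of_le_of_ne (sum_nonneg fun i _ => sq_nonneg _) fun h0 => ?_
  -- Below the threshold the term is `-σ i ≠ 0`; above it, `2 (σ i - τ) = σ i`.
  have hall : ∀ i, σ i = 2 * τ := by
    intro i
    have := pow_eq_zero_iff two_ne_zero |>.mp
      ((sum_eq_zero_iff_of_nonneg fun i _ => sq_nonneg _).mp h0.symm i (mem_univ i))
    have hi := h.pos i
    rcases le_total (σ i - τ) 0 with hle | hle
    · rw [max_eq_right hle] at this
      linarith
    · rw [max_eq_left hle] at this
      linarith
  have := h.strictAnti (show (⟨0, by omega⟩ : Fin k) < ⟨1, by omega⟩ by simp)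
  rw [hall, hall] at this
  exact lt_irrefl _ this

end Minimizer

/-! ### Exceptional spectra lie on finitely many hyperplanes -/

section Genericity

variable {k : ℕ}

open MeasureTheory in
theorem ae_sum_mul_ne_zero {c : Fin k → ℝ} (hc : c ≠ 0) :
    ∀ᵐ σ : Fin k → ℝ ∂volume, ∑ i, c i * σ i ≠ 0 := by
  have hne : LinearMap.ker (Fintype.linearCombination ℝ c) ≠ ⊤ := by
    intro htop
    refine hc (funext fun i => ?_)
    have : Pi.single i 1 ∈ LinearMap.ker (Fintype.linearCombination ℝ c) := htop ▸ trivial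
    simpa [Fintype.linearCombination_apply_single] using this
  have := Measure.addHaar_submodule (volume : Measure (Fin k → ℝ)) _ hne
  rw [ae_iff]
  convert this using 2
  ext σ
  simp [Fintype.linearCombination_apply, mul_comm]

open MeasureTheory in
/-- For almost every spectrum, no partial sum of length `r < k` equals `2 r` times the threshold. -/
theorem ae_threshold_ne (k : ℕ) : ∀ᵐ σ : Fin k → ℝ ∂volume,
    ∀ τ : ℝ, 0 < k → ∑ i, max (σ i - τ) 0 = k * τ →
      ∀ r : ℕ, 1 ≤ r → r < k → 2 * r * τ ≠ ∑ i : Fin k with i.val < r, σ i := by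
  -- If `T` is the set of `σ_i > τ`, then `∑_T σ_i = (k + |T|)τ`. Eliminating `τ` from `2rτ =
  -- ∑_{i≤r} σ_i` leaves this linear form equal to zero. Taking every `T` makes the null set
  -- independent of `τ`.
  have key : ∀ (T : Finset (Fin k)) (r : Fin k), 1 ≤ r.val → ∀ᵐ σ : Fin k → ℝ ∂volume,
      ∑ i, ((if i ∈ T then 2 * (r.val : ℝ) else 0) -
        (if i.val < r.val then (k + T.card : ℝ) else 0)) * σ i ≠ 0 := by
    intro T r hr
    refine ae_sum_mul_ne_zero fun h0 => ?_
    -- Both `2r` and `k + |T|` are positive and they differ in sign in the form, so a coefficient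
    -- can vanish only where the two indicators agree.
    have hT : T = univ.filter fun i : Fin k => i.val < r.val := by
      ext i
      have hi := congrFun h0 i
      have hr' : (1 : ℝ) ≤ r.val := by exact_mod_cast hr
      have hk' : (0 : ℝ) < k := by exact_mod_cast i.pos
      by_cases h1 : i ∈ T <;> by_cases h2 : i.val < r.val
      · simpa [h1] using h2
      · simp [h1, h2] at hi
        omega
      · simp [h1, h2] at hi
        have : (0 : ℝ) ≤ T.card := by positivity
        linarith
      · simpa [h1] using h2
    have hcard : T.card = r.val := by
      rw [hT, Fin.card_filter_val_lt]
      exact min_eq_right r.isLt.le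
    -- With `|T| = r` the first coefficient is `2r - (k + r) = r - k`, nonzero exactly because `r <
    -- k`.
    have hi := congrFun h0 ⟨0, r.pos⟩
    have h0r : (⟨0, r.pos⟩ : Fin k).val < r.val := hr
    have hmem : (⟨0, r.pos⟩ : Fin k) ∈ T := by
      rw [hT]
      exact mem_filter.mpr ⟨mem_univ _, h0r⟩
    rw [if_pos hmem, if_pos h0r, hcard, Pi.zero_apply] at hi
    have : (r.val : ℝ) < k := by exact_mod_cast r.isLt
    linarith
  have hae : ∀ᵐ σ : Fin k → ℝ ∂volume, ∀ (T : Finset (Fin k)) (r : Fin k), 1 ≤ r.val →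
      ∑ i, ((if i ∈ T then 2 * (r.val : ℝ) else 0) -
        (if i.val < r.val then (k + T.card : ℝ) else 0)) * σ i ≠ 0 := by
    rw [ae_all_iff]
    intro T
    rw [ae_all_iff]
    intro r
    by_cases hr : 1 ≤ r.val
    · filter_upwards [key T r hr] with σ hσ _ using hσ
    · exact Filter.Eventually.of_forall fun σ h => absurd h hr
  filter_upwards [hae] with σ hσ τ hk hτ r hr hrk heq
  refine hσ (univ.filter fun i => τ < σ i) ⟨r, hrk⟩ hr ?_
  have hsum : ∑ i with τ < σ i, σ i =
      (k + (univ.filter fun i => τ < σ i).card : ℝ) * τ := by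
    have : ∑ i, max (σ i - τ) 0 = ∑ i with τ < σ i, (σ i - τ) := by
      rw [sum_filter]
      refine sum_congr rfl fun i _ => ?_
      split_ifs with hi
      · exact max_eq_left (sub_pos.mpr hi).le
      · exact max_eq_right (sub_nonpos.mpr (not_lt.mp hi))
    rw [this, sum_sub_distrib, sum_const, nsmul_eq_mul] at hτ
    linarith
  simp only [sub_mul, ite_mul, zero_mul, sum_sub_distrib, mem_filter, mem_univ, true_and]
  rw [← sum_filter, ← sum_filter, ← mul_sum, ← mul_sum, hsum, ← heq]
  ring

end Genericity

end ElasticLinear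

/-! ### Assembly of the theorem -/

theorem theorem4p2 (m n k : ℕ) (hk : k = min m n) :
    -- the lower bound on the gap, for every target, every minimizer and every rank
    (∀ (M : Matrix (Fin m) (Fin n) ℝ) (P : Matrix (Fin m) (Fin k) ℝ) (σ : Fin k → ℝ)
        (Q : Matrix (Fin n) (Fin k) ℝ), ElasticLinear.IsSimpleSVD M P σ Q →
      ∀ (U : Matrix (Fin m) (Fin k) ℝ) (V : Matrix (Fin n) (Fin k) ℝ),
        ElasticLinear.IsASLMinimizer M U V →
      ∀ r : ℕ, 1 ≤ r → r ≤ k →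
        ElasticLinear.submodelGap U V P σ Q r ≥ ElasticLinear.gapBound U V σ r) ∧
    -- strict positivity for Lebesgue-almost every spectrum
    (∀ᵐ σ : Fin k → ℝ ∂MeasureTheory.volume,
      ∀ (M : Matrix (Fin m) (Fin n) ℝ) (P : Matrix (Fin m) (Fin k) ℝ)
        (Q : Matrix (Fin n) (Fin k) ℝ), ElasticLinear.IsSimpleSVD M P σ Q →
      ∀ (U : Matrix (Fin m) (Fin k) ℝ) (V : Matrix (Fin n) (Fin k) ℝ),
        ElasticLinear.IsASLMinimizer M U V →
      (∀ r : ℕ, 1 ≤ r → r < k → 0 < ElasticLinear.gapBound U V σ r) ∧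
      (2 ≤ k → ∀ r : ℕ, 1 ≤ r → r ≤ k → 0 < ElasticLinear.submodelGap U V P σ Q r)) := by
  refine ⟨fun M P σ Q h U V hUV r hr hrk => hUV.gapBound_le_submodelGap h hr hrk, ?_⟩
  filter_upwards [ElasticLinear.ae_threshold_ne k] with σ hσ M P Q h U V hUV
  have hpos : ∀ r : ℕ, 1 ≤ r → r < k → 0 < ElasticLinear.gapBound U V σ r := by
    intro r hr hrk
    have hk0 : 0 < k := by omega
    obtain ⟨τ, hτ0, hτ⟩ := ElasticLinear.exists_threshold hk0 h.pos
    rw [hUV.gapBound_eq hk0 h hτ0 hτ]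
    have := sub_ne_zero.mpr (hσ τ hk0 hτ r hr hrk)
    positivity
  refine ⟨hpos, fun hk2 r hr hrk => ?_⟩
  rcases hrk.lt_or_eq with hlt | rfl
  · exact (hpos r hr hlt).trans_le (hUV.gapBound_le_submodelGap h hr hrk)
  · exact hUV.submodelGap_self_pos hk2 h
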